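/- For $N\ge 1$ let $\mathfrak{S}_N$ be the group of permutations of $[N]=\{1,\dots,N\}$, and for $x\in\mathfrak{S}_N$ let $\ell_{\mathbf 2}(x)$ be the minimal number of factors in an expression of $x$ as a product of transpositions. Write $u\le_{\mathbf 2} v$ if $\ell_{\mathbf 2}(v)=\ell_{\mathbf 2}(u)+\ell_{\mathbf 2}(u^{-1}v)$. The noncrossing partitions of $[N]$ are, by definition, the permutations $x\in\mathfrak{S}_N$ with $x\le_{\mathbf 2} c$, where $c=(1\;2\;\ldots\;N)$ is the long cycle; let $N\!C_N$ denote the set of them. A permutation $x$ satisfies Property (OD) if for each of its cycles (fixed points counted as cycles of length one), with letters written in increasing order as $u_1<u_2<\cdots<u_q$, the number $q$ is odd and $u_{j+1}-u_j$ is odd for all $1\le j\le q-1$. Let $O\!N\!C_N$ be the set of all $x\in N\!C_N$ which satisfy Property (OD). **Proposition.** For every integer $n\ge 1$, $$\bigl|O\!N\!C_{2n}\bigr|=\frac{1}{2n+1}\binom{3n}{n}.$$ -/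

import Mathlib

/-- The word length of `g` with respect to a generating set `T`: the least `k` such that `g` is a
product of `k` elements of `T`. -/
noncomputable def wordLength {G : Type*} [Group G] (T : Set G) (g : G) : ℕ :=
  sInf {k : ℕ | ∃ l : List G, l.length = k ∧ (∀ t ∈ l, t ∈ T) ∧ l.prod = g}

/-- The prefix order induced by `T`: `u ≤ v` if and only if `ℓ(v) = ℓ(u) + ℓ(u⁻¹ v)`. -/
def PrefixLE {G : Type*} [Group G] (T : Set G) (u v : G) : Prop :=
  wordLength T v = wordLength T u + wordLength T (u⁻¹ * v)

/-- The set of all transpositions of the symmetric group on `N` letters. -/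
def transpositions (N : ℕ) : Set (Equiv.Perm (Fin N)) :=
  {t | t.IsSwap}

/-- The noncrossing partitions of `[N]`, viewed as permutations: those `x` that lie below the long
cycle `c = (1 2 … N)` in the absolute order. The letter `i ∈ [N]` is represented by
`i - 1 : Fin N`, so that `c` is `finRotate N`. -/
def NC (N : ℕ) : Set (Equiv.Perm (Fin N)) :=
  {x | PrefixLE (transpositions N) x (finRotate N)}

open Classical in
/-- The set of letters of the cycle of `x` that contains `i` (equal to `{i}` if `x` fixes `i`). -/
noncomputable def cycleLetters {N : ℕ} (x : Equiv.Perm (Fin N)) (i : Fin N) : Finset (Fin N) :=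
  Finset.univ.filter fun j => x.SameCycle i j

/-- Property OD for a set of letters `u_1 < u_2 < ⋯ < u_q`: `q` is odd, and `u_{j+1} - u_j` is odd
for all `1 ≤ j ≤ q - 1`. Here `u_{j+1}` is `B.orderEmbOfFin rfl j`, with `j` running from `0`. -/
def LettersOD {N : ℕ} (B : Finset (Fin N)) : Prop :=
  Odd B.card ∧
    ∀ (j : ℕ) (hj : j + 1 < B.card),
      Odd (((B.orderEmbOfFin rfl ⟨j + 1, hj⟩ : ℕ) : ℤ) -
        ((B.orderEmbOfFin rfl ⟨j, Nat.lt_of_succ_lt hj⟩ : ℕ) : ℤ))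

/-- A permutation satisfies Property OD if all its cycles (fixed points included) do. -/
def PropertyOD {N : ℕ} (x : Equiv.Perm (Fin N)) : Prop :=
  ∀ i : Fin N, LettersOD (cycleLetters x i)

/-- The noncrossing partitions of `[N]` that satisfy Property OD. -/
def ONC (N : ℕ) : Set (Equiv.Perm (Fin N)) :=
  {x | x ∈ NC N ∧ PropertyOD x}

/-!
The absolute length of a permutation is its rank, the codimension of the space of functions that are
constant on its cycles (`wordLength_transpositions`). Subadditivity of codimension gives the
triangle inequality, and in the case of equality the invariants of `u * v` are those common to `u`
and `v`; hence the cycles of `u` refine those of `v` whenever `u` lies below `v`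
(`Below.preserves`).

Permutations `x` below the cycle of the letters of `[a, b)` are sorted by the value at the first
letter `a`. If `x a = a`, then `x` lies below the cycle of `[a + 1, b)`. If `x a = m` with `a < m`,
then multiplying by the transposition `(a m)` splits the long cycle into the cycles of `[a, m)` and
`[m, b)`, and `x = (a m) * (y * z)` for unique `y` below the cycle of `[a + 1, m)` and `z` below the
cycle of `[m, b)` (`below_swap_mul`, `exists_of_below_rot`, `mul_eq_mul_of_below_rot`). The cycle of
`a` in `x` consists of `a` and the cycle of `m` in `z`, so Property OD for `x` means that `m - a` is
odd, that `y` has Property OD, and that `z` satisfies a variant of Property OD in which the cycle of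
the first letter has even length (`firstCycle_swap_mul_iff`).

This gives a pair of convolution recursions for the numbers of permutations with Property OD and
with its variant. Let `B` be the power series with `B = 1 + X ^ 2 * B ^ 3`. The generating function
`B + X * B ^ 2` for Property OD, together with its companion `firstSeries` for the variant, solves
these recursions (`counts_eq_coeff`). Its even part is `B`, and the coefficients of the powers of
`B` are computed from `B ^ (p + 1) = B ^ p + X ^ 2 * B ^ (p + 3)` (`add_mul_ternaryCoeff`).
-/

/-! ### The rank of a permutation -/

/-- The functions that are constant on the cycles of `g`. -/
def invariants {α : Type*} (g : Equiv.Perm α) : Submodule ℚ (α → ℚ) where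
  carrier := {f | ∀ i, f (g i) = f i}
  add_mem' := fun hf hh i => by simp [hf i, hh i]
  zero_mem' := fun i => rfl
  smul_mem' := fun c f hf i => by simp [hf i]

/-- The rank of a permutation: the codimension of the space of functions that are constant on its
cycles. -/
noncomputable def rk {α : Type*} [Fintype α] (g : Equiv.Perm α) : ℕ :=
  Fintype.card α - Module.finrank ℚ (invariants g)

section Rank

variable {α : Type*}

theorem mem_invariants {g : Equiv.Perm α} {f : α → ℚ} :
    f ∈ invariants g ↔ ∀ i, f (g i) = f i := Iff.rfl

theorem invariants_inf_le_mul (g h : Equiv.Perm α) :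
    invariants g ⊓ invariants h ≤ invariants (g * h) := by
  rintro f ⟨hg, hh⟩ i
  rw [Equiv.Perm.mul_apply, hg, hh]

theorem invariants_inv (g : Equiv.Perm α) : invariants g⁻¹ = invariants g := by
  ext f
  refine ⟨fun h i => ?_, fun h i => ?_⟩
  · simpa using (h (g i)).symm
  · simpa using (h (g⁻¹ i)).symm

theorem invariants_one : invariants (1 : Equiv.Perm α) = ⊤ := by
  ext f; simp [mem_invariants]

theorem eq_one_of_invariants_eq_top [DecidableEq α] {g : Equiv.Perm α} (h : invariants g = ⊤) :
    g = 1 := by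
  ext i
  have := (mem_invariants.1 (h ▸ Submodule.mem_top : Pi.single i (1 : ℚ) ∈ invariants g)) i
  by_contra hne
  simp [show g i ≠ i from hne] at this

variable [Fintype α]

theorem finrank_invariants_le (g : Equiv.Perm α) :
    Module.finrank ℚ (invariants g) ≤ Fintype.card α := by
  simpa using Submodule.finrank_le (invariants g)

theorem finrank_add_rk (g : Equiv.Perm α) :
    Module.finrank ℚ (invariants g) + rk g = Fintype.card α := by
  have := finrank_invariants_le g
  unfold rk; omega

theorem rk_inv (g : Equiv.Perm α) : rk g⁻¹ = rk g := by
  unfold rk; rw [invariants_inv]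

theorem rk_one : rk (1 : Equiv.Perm α) = 0 := by
  unfold rk; rw [invariants_one]; simp

theorem card_le_finrank_inf_add (g h : Equiv.Perm α) :
    Fintype.card α ≤
      Module.finrank ℚ (invariants g ⊓ invariants h : Submodule ℚ (α → ℚ)) + rk g + rk h := by
  have h1 := Submodule.finrank_sup_add_finrank_inf_eq (invariants g) (invariants h)
  have h2 : Module.finrank ℚ (invariants g ⊔ invariants h : Submodule ℚ (α → ℚ)) ≤
      Fintype.card α := by
    simpa using Submodule.finrank_le (invariants g ⊔ invariants h)
  have h3 := finrank_add_rk g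
  have h4 := finrank_add_rk h
  omega

theorem rk_mul_le (g h : Equiv.Perm α) : rk (g * h) ≤ rk g + rk h := by
  have h1 := card_le_finrank_inf_add g h
  have h2 := Submodule.finrank_mono (invariants_inf_le_mul g h)
  have h3 := finrank_add_rk (g * h)
  omega

/-- If the rank is additive on a product, then every function invariant under the product is
invariant under the first factor; thus the cycles of the factor refine those of the product. -/
theorem invariants_le_of_rk_mul_eq {g h : Equiv.Perm α} (e : rk (g * h) = rk g + rk h) :
    invariants (g * h) ≤ invariants g := by
  have h1 := card_le_finrank_inf_add g h
  have h3 := finrank_add_rk (g * h)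
  have := Submodule.eq_of_le_of_finrank_le (invariants_inf_le_mul g h) (by omega)
  rw [← this]
  exact inf_le_left

theorem rk_mul_of_disjoint {g h : Equiv.Perm α} (hd : g.Disjoint h) :
    rk (g * h) = rk g + rk h := by
  classical
  have hle : invariants (g * h) ≤ invariants g ⊓ invariants h := by
    intro f hf
    have hf' := mem_invariants.1 hf
    refine ⟨fun i => ?_, fun i => ?_⟩
    · rcases hd i with hi | hi
      · rw [hi]
      · simpa [hi] using hf' i
    · rcases hd i with hi | hi
      · have := hf' i
        rw [hd.commute.eq] at this
        simpa [hi] using this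
      · rw [hi]
  have hinf : invariants (g * h) = invariants g ⊓ invariants h :=
    le_antisymm hle (invariants_inf_le_mul g h)
  -- A function splits into its parts off and on the support of `g`, which are invariant
  -- under `g` and under `h`.
  have hsup : invariants g ⊔ invariants h = ⊤ := by
    rw [eq_top_iff]
    intro f _
    have hf : f = (fun i => if g i = i then f i else 0) + fun i => if g i = i then 0 else f i := by
      ext i; by_cases hi : g i = i <;> simp [hi]
    rw [hf]
    refine Submodule.add_mem_sup (fun i => ?_) (fun i => ?_)
    · by_cases hi : g i = i
      · simp [hi]
      · simp [hi]
    · by_cases hi : h i = i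
      · simp [hi]
      · have h1 : g i = i := (hd i).resolve_right hi
        have h2 : g (h i) = h i := (hd (h i)).resolve_right (by simpa using hi)
        simp [h1, h2]
  have h1 := Submodule.finrank_sup_add_finrank_inf_eq (invariants g) (invariants h)
  rw [hsup, ← hinf, finrank_top, Module.finrank_fintype_fun_eq_card] at h1
  have h2 := finrank_add_rk g
  have h3 := finrank_add_rk h
  have h4 := finrank_add_rk (g * h)
  omega

variable [DecidableEq α]

theorem rk_swap_le_one (i j : α) : rk (Equiv.swap i j) ≤ 1 := by
  by_cases hij : i = j
  · subst hij; simp [← Equiv.Perm.one_def, rk_one]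
  let φ : (α → ℚ) →ₗ[ℚ] ℚ := LinearMap.proj (R := ℚ) (φ := fun _ : α => ℚ) i - LinearMap.proj j
  have hker : LinearMap.ker φ ≤ invariants (Equiv.swap i j) := by
    intro f hf k
    have hf' : f i = f j := by simpa [φ, sub_eq_zero] using hf
    by_cases h1 : k = i
    · subst h1; simp [hf']
    · by_cases h2 : k = j
      · subst h2; simp [hf']
      · rw [Equiv.swap_apply_of_ne_of_ne h1 h2]
  have h1 := Submodule.finrank_mono hker
  have h2 := LinearMap.finrank_range_add_finrank_ker φ
  have h3 : Module.finrank ℚ (LinearMap.range φ) ≤ 1 := by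
    simpa using Submodule.finrank_le (LinearMap.range φ)
  rw [Module.finrank_fintype_fun_eq_card] at h2
  have := finrank_add_rk (Equiv.swap i j)
  omega

/-- Splitting the point `i` off its cycle lowers the rank by one. -/
theorem rk_swap_mul {g : Equiv.Perm α} {i : α} (hi : g i ≠ i) :
    rk (Equiv.swap i (g i) * g) + 1 = rk g := by
  have hle : rk g ≤ 1 + rk (Equiv.swap i (g i) * g) := by
    have h1 := rk_mul_le (Equiv.swap i (g i)) (Equiv.swap i (g i) * g)
    rw [Equiv.swap_mul_self_mul] at h1
    have := rk_swap_le_one i (g i)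
    omega
  have hlt : invariants g < invariants (Equiv.swap i (g i) * g) := by
    refine lt_of_le_of_ne (fun f hf k => ?_) (fun h => ?_)
    · have hf' := mem_invariants.1 hf
      rw [Equiv.Perm.mul_apply]
      by_cases h1 : k = i
      · subst h1; simp
      · by_cases h2 : g k = i
        · rw [h2, Equiv.swap_apply_left, hf', ← hf' k, h2]
        · rw [Equiv.swap_apply_of_ne_of_ne h2 (by simpa using h1), hf']
    · -- The indicator function of `i` tells the two spaces apart.
      have hmem : Pi.single i (1 : ℚ) ∈ invariants (Equiv.swap i (g i) * g) := by
        have hfix : (Equiv.swap i (g i) * g) i = i := by simp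
        intro k
        by_cases h1 : k = i
        · rw [h1, hfix]
        · have : (Equiv.swap i (g i) * g) k ≠ i := fun h2 =>
            h1 ((Equiv.swap i (g i) * g).injective (h2.trans hfix.symm))
          simp [h1, -Equiv.Perm.coe_mul, this]
      rw [← h] at hmem
      have := mem_invariants.1 hmem i
      simp [hi] at this
  have h1 := Submodule.finrank_lt_finrank_of_lt hlt
  have h2 := finrank_add_rk g
  have h3 := finrank_add_rk (Equiv.swap i (g i) * g)
  omega

theorem rk_mul_swap {g : Equiv.Perm α} {i : α} (hi : g i ≠ i) :
    rk (g * Equiv.swap (g i) i) + 1 = rk g := by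
  have h : g⁻¹ (g i) ≠ g i := by simpa using hi.symm
  have := rk_swap_mul h
  rw [rk_inv, show g⁻¹ (g i) = i by simp] at this
  rw [← this, ← rk_inv]
  simp

theorem rk_prod_le_length (l : List (Equiv.Perm α)) (hl : ∀ t ∈ l, t.IsSwap) :
    rk l.prod ≤ l.length := by
  induction l with
  | nil => simp [rk_one]
  | cons t l ih =>
    obtain ⟨i, j, -, rfl⟩ := hl t (by simp)
    have h1 := rk_mul_le (Equiv.swap i j) l.prod
    have h2 := rk_swap_le_one i j
    have h3 := ih fun t ht => hl t (by simp [ht])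
    simp only [List.prod_cons, List.length_cons]
    omega

theorem exists_list_of_rk (k : ℕ) (g : Equiv.Perm α) (hk : rk g = k) :
    ∃ l : List (Equiv.Perm α), l.length = k ∧ (∀ t ∈ l, t.IsSwap) ∧ l.prod = g := by
  induction k generalizing g with
  | zero =>
    refine ⟨[], rfl, by simp, ?_⟩
    have h1 := finrank_add_rk g
    refine (eq_one_of_invariants_eq_top (Submodule.eq_top_of_finrank_eq ?_)).symm
    rw [Module.finrank_fintype_fun_eq_card]; omega
  | succ k ih =>
    have hg : g ≠ 1 := by rintro rfl; simp [rk_one] at hk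
    obtain ⟨i, hi⟩ : ∃ i, g i ≠ i := by
      by_contra! h; exact hg (Equiv.ext h)
    obtain ⟨l, h1, h2, h3⟩ := ih (Equiv.swap i (g i) * g) (by have := rk_swap_mul hi; omega)
    refine ⟨Equiv.swap i (g i) :: l, by simp [h1], ?_, ?_⟩
    · simp only [List.mem_cons, forall_eq_or_imp]
      exact ⟨⟨i, g i, hi.symm, rfl⟩, h2⟩
    · rw [List.prod_cons, h3, Equiv.swap_mul_self_mul]

end Rank

theorem wordLength_transpositions {N : ℕ} (g : Equiv.Perm (Fin N)) :
    wordLength (transpositions N) g = rk g := by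
  refine le_antisymm (Nat.sInf_le (exists_list_of_rk _ g rfl))
    (le_csInf ⟨_, exists_list_of_rk _ g rfl⟩ ?_)
  rintro k ⟨l, rfl, hl, rfl⟩
  exact rk_prod_le_length l hl

/-! ### The absolute order below the cycles of consecutive letters -/

/-- The prefix order in terms of the rank: `u` lies below `v` in the absolute order. -/
def Below {α : Type*} [Fintype α] (u v : Equiv.Perm α) : Prop :=
  rk v = rk u + rk (u⁻¹ * v)

section Below

variable {α : Type*} [Fintype α]

/-- A set that is preserved by `v` is preserved by every permutation below `v`. -/
theorem Below.preserves {u v : Equiv.Perm α} (h : Below u v) (p : α → Prop)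
    (hp : ∀ k, p (v k) ↔ p k) (k : α) : p (u k) ↔ p k := by
  classical
  have h1 : invariants v ≤ invariants u := by
    have := invariants_le_of_rk_mul_eq (g := u) (h := u⁻¹ * v)
      (by rw [mul_inv_cancel_left]; exact h)
    rwa [mul_inv_cancel_left] at this
  have h2 : (fun k => if p k then (1 : ℚ) else 0) ∈ invariants u := h1 fun k => by simp [hp k]
  have h3 := h2 k
  by_cases ha : p (u k) <;> by_cases hb : p k <;> simp_all

theorem Below.fixed {u v : Equiv.Perm α} (h : Below u v) {i : α} (hi : v i = i) : u i = i :=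
  (h.preserves (· = i)
    (fun k => ⟨fun hk => v.injective (hk.trans hi.symm), fun hk => by rw [hk, hi]⟩) i).2 rfl

theorem below_one_iff {u : Equiv.Perm α} : Below u 1 ↔ u = 1 := by
  refine ⟨fun h => Equiv.ext fun i => h.fixed rfl, ?_⟩
  rintro rfl
  simp [Below, rk_one]

theorem below_mul_iff (p : α → Prop) {y z c d : Equiv.Perm α}
    (hy : ∀ k, ¬ p k → y k = k) (hc : ∀ k, ¬ p k → c k = k)
    (hz : ∀ k, p k → z k = k) (hd : ∀ k, p k → d k = k) :
    Below (y * z) (c * d) ↔ Below y c ∧ Below z d := by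
  have hy' : ∀ k, ¬ p k → y⁻¹ k = k := fun k hk => by
    rw [Equiv.Perm.inv_eq_iff_eq, hy k hk]
  have hz' : ∀ k, p k → z⁻¹ k = k := fun k hk => by
    rw [Equiv.Perm.inv_eq_iff_eq, hz k hk]
  have hyc : ∀ k, ¬ p k → (y⁻¹ * c) k = k := fun k hk => by
    rw [Equiv.Perm.mul_apply, hc k hk, hy' k hk]
  have hzd : ∀ k, p k → (z⁻¹ * d) k = k := fun k hk => by
    rw [Equiv.Perm.mul_apply, hd k hk, hz' k hk]
  have disj : ∀ {g h : Equiv.Perm α}, (∀ k, ¬ p k → g k = k) → (∀ k, p k → h k = k) →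
      g.Disjoint h := fun hg hh k => by
    by_cases hk : p k
    · exact Or.inr (hh k hk)
    · exact Or.inl (hg k hk)
  have e : (y * z)⁻¹ * (c * d) = (y⁻¹ * c) * (z⁻¹ * d) := by
    have := (disj hyc hz').commute.eq
    rw [mul_inv_rev, mul_assoc z⁻¹, ← mul_assoc y⁻¹, ← mul_assoc, ← this, mul_assoc]
  have h1 := rk_mul_le y (y⁻¹ * c)
  have h2 := rk_mul_le z (z⁻¹ * d)
  rw [mul_inv_cancel_left] at h1 h2
  unfold Below
  rw [e, rk_mul_of_disjoint (disj hy hz), rk_mul_of_disjoint (disj hc hd),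
    rk_mul_of_disjoint (disj hyc hzd)]
  omega

end Below

section Letters

variable {N : ℕ}

/-- The cycle `(a a+1 … b-1)` on the letters of the half-open interval `[a, b)`; it is the identity
if this interval has at most one letter. -/
def rot (a b : ℕ) (hb : b ≤ N) : Equiv.Perm (Fin N) where
  toFun i := ⟨if a ≤ i ∧ (i : ℕ) + 1 < b then i + 1 else if a ≤ i ∧ (i : ℕ) + 1 = b then a else i,
    by split_ifs <;> omega⟩
  invFun i := ⟨if a < i ∧ (i : ℕ) < b then i - 1 else if a = i ∧ a < b then b - 1 else i,
    by split_ifs <;> omega⟩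
  left_inv i := by
    ext
    dsimp only
    split_ifs <;> omega
  right_inv i := by
    ext
    dsimp only
    split_ifs <;> omega

theorem rot_val (a b : ℕ) (hb : b ≤ N) (i : Fin N) : (rot a b hb i : ℕ) =
    if a ≤ i ∧ (i : ℕ) + 1 < b then (i : ℕ) + 1
    else if a ≤ i ∧ (i : ℕ) + 1 = b then a else i := rfl

theorem rot_of_lt {a b : ℕ} {hb : b ≤ N} {i : Fin N} (hi : (i : ℕ) < a) : rot a b hb i = i := by
  ext; rw [rot_val]; split_ifs <;> omega

theorem rot_of_ge {a b : ℕ} {hb : b ≤ N} {i : Fin N} (hi : b ≤ i) : rot a b hb i = i := by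
  ext; rw [rot_val]; split_ifs <;> omega

theorem rot_eq_one {a b : ℕ} {hb : b ≤ N} (h : b ≤ a + 1) : rot a b hb = 1 := by
  ext i; rw [rot_val, Equiv.Perm.one_apply]; split_ifs <;> omega

theorem swap_val (i j k : Fin N) : (Equiv.swap i j k : ℕ) =
    if (k : ℕ) = i then (j : ℕ) else if (k : ℕ) = j then (i : ℕ) else k := by
  rw [Equiv.swap_apply_def]
  simp only [Fin.ext_iff]
  split_ifs <;> rfl

theorem swap_mul_rot {a m : Fin N} {b : ℕ} (hb : b ≤ N) (ham : a < m) (hmb : (m : ℕ) < b) :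
    Equiv.swap a m * rot a b hb = rot a m m.2.le * rot m b hb := by
  have : (a : ℕ) < m := ham
  ext i
  rw [Equiv.Perm.mul_apply, Equiv.Perm.mul_apply, swap_val, rot_val, rot_val, rot_val]
  split_ifs <;> omega

theorem rot_mul_swap {a l : Fin N} {b : ℕ} (hb : b ≤ N) (h : (a : ℕ) + 1 < b)
    (hl : (l : ℕ) + 1 = b) :
    rot a b hb * Equiv.swap a l = rot (a + 1) b hb := by
  ext i
  rw [Equiv.Perm.mul_apply, rot_val, rot_val, swap_val]
  split_ifs <;> omega

theorem rk_rot_succ {a m : Fin N} {b : ℕ} (hb : b ≤ N) (hm : (m : ℕ) = a + 1)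
    (h : (m : ℕ) < b) : rk (rot (a + 1) b hb) + 1 = rk (rot a b hb) := by
  have h1 : rot a b hb a = m := by
    ext; rw [rot_val]; split_ifs <;> omega
  have h2 : rot a b hb a ≠ a := by rw [h1, ne_eq, Fin.ext_iff]; omega
  have h3 := rk_swap_mul h2
  have h4 : rot a m m.2.le = 1 := rot_eq_one hm.le
  rw [h1, swap_mul_rot hb (by rw [Fin.lt_def]; omega) h, h4, one_mul] at h3
  rw [← h3, hm]

theorem rk_rot {a b : ℕ} (hb : b ≤ N) (h : a < b) : rk (rot a b hb) + a + 1 = b := by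
  obtain ⟨d, hd⟩ : ∃ d, b = a + 1 + d := ⟨b - (a + 1), by omega⟩
  induction d generalizing a with
  | zero => rw [rot_eq_one (by omega), rk_one]; omega
  | succ d ih =>
    have h1 := ih (a := a + 1) (by omega) (by omega)
    have h2 := rk_rot_succ (a := ⟨a, by omega⟩) (m := ⟨a + 1, by omega⟩) hb rfl
      (show a + 1 < b by omega)
    simp only at h2
    omega

theorem below_rot_of_fixed {x : Equiv.Perm (Fin N)} {a : Fin N} {b : ℕ} (hb : b ≤ N)
    (hx : x a = a) : Below x (rot a b hb) ↔ Below x (rot (a + 1) b hb) := by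
  by_cases h : (a : ℕ) + 1 < b
  · obtain ⟨l, hl⟩ : ∃ l : Fin N, (l : ℕ) + 1 = b := ⟨⟨b - 1, by omega⟩, by simp; omega⟩
    have h1 : (x⁻¹ * rot a b hb) l = a := by
      rw [Equiv.Perm.mul_apply, Equiv.Perm.inv_eq_iff_eq, hx]
      ext; rw [rot_val]; split_ifs <;> omega
    have h2 : (x⁻¹ * rot a b hb) l ≠ l := by
      rw [h1, ne_eq, Fin.ext_iff]; omega
    have h3 := rk_mul_swap h2
    rw [h1, mul_assoc, rot_mul_swap hb h hl] at h3
    have h4 := rk_rot hb h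
    have h5 := rk_rot hb (show (a : ℕ) < b by omega)
    unfold Below
    omega
  · rw [rot_eq_one (by omega), rot_eq_one (by omega)]

theorem below_rot_of_apply {x : Equiv.Perm (Fin N)} {a m : Fin N} {b : ℕ} (hb : b ≤ N)
    (ham : a < m) (hmb : (m : ℕ) < b) (hx : x a = m) :
    Below x (rot a b hb) ↔ Below (Equiv.swap a m * x) (rot a m m.2.le * rot m b hb) := by
  have ham' : (a : ℕ) < m := ham
  have h1 := rk_swap_mul (g := x) (i := a) (by rw [hx]; exact ham.ne')
  have hd : (rot (a : ℕ) m m.2.le : Equiv.Perm (Fin N)).Disjoint (rot m b hb) := fun k => by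
    by_cases hk : (k : ℕ) < m
    · exact Or.inr (rot_of_lt hk)
    · exact Or.inl (rot_of_ge (by omega))
  have h2 := rk_mul_of_disjoint hd
  have h3 := rk_rot (N := N) m.2.le ham'
  have h4 := rk_rot hb hmb
  have h5 := rk_rot hb (ham'.trans hmb)
  have h6 : (Equiv.swap a m * x)⁻¹ * (rot a m m.2.le * rot m b hb) = x⁻¹ * rot a b hb := by
    rw [← swap_mul_rot hb ham hmb]; group
  rw [hx] at h1
  unfold Below
  rw [h6]
  omega

/-- Together with `exists_of_below_rot` and `mul_eq_mul_of_below_rot`, this describes the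
permutations `x` below the cycle of `[a, b)` with `x a = m`: they correspond to the pairs of a
permutation below the cycle of `[a + 1, m)` and one below the cycle of `[m, b)`. -/
theorem below_swap_mul {a m : Fin N} {b : ℕ} (hb : b ≤ N) (ham : a < m) (hmb : (m : ℕ) < b)
    {y z : Equiv.Perm (Fin N)} (hy : Below y (rot (a + 1) m m.2.le))
    (hz : Below z (rot m b hb)) :
    Below (Equiv.swap a m * (y * z)) (rot a b hb) ∧ (Equiv.swap a m * (y * z)) a = m := by
  have hya : y a = a := hy.fixed (rot_of_lt (by omega))
  have hza : z a = a := hz.fixed (rot_of_lt ham)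
  have hx : (Equiv.swap a m * (y * z)) a = m := by
    simp [Equiv.Perm.mul_apply, hza, hya]
  refine ⟨?_, hx⟩
  rw [below_rot_of_apply hb ham hmb hx, Equiv.swap_mul_self_mul,
    below_mul_iff (fun k : Fin N => (k : ℕ) < m)]
  · exact ⟨(below_rot_of_fixed _ hya).2 hy, hz⟩
  · exact fun k hk => hy.fixed (rot_of_ge (by omega))
  · exact fun k hk => rot_of_ge (by omega)
  · exact fun k hk => hz.fixed (rot_of_lt hk)
  · exact fun k hk => rot_of_lt hk

theorem exists_of_below_rot {a m : Fin N} {b : ℕ} (hb : b ≤ N) (ham : a < m)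
    (hmb : (m : ℕ) < b) {x : Equiv.Perm (Fin N)} (hx : Below x (rot a b hb)) (hxa : x a = m) :
    ∃ y z, Below y (rot (a + 1) m m.2.le) ∧ Below z (rot m b hb) ∧
      Equiv.swap a m * (y * z) = x := by
  rw [below_rot_of_apply hb ham hmb hxa] at hx
  set w := Equiv.swap a m * x with hw
  have hwa : w a = a := by simp [hw, hxa]
  have hp : ∀ k, ((w k : Fin N) : ℕ) < m ↔ (k : ℕ) < m := by
    refine hx.preserves (fun k : Fin N => (k : ℕ) < m) fun k => ?_
    have ham' : (a : ℕ) < m := ham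
    rw [Equiv.Perm.mul_apply, rot_val, rot_val]
    split_ifs <;> omega
  set y := Equiv.Perm.ofSubtype (w.subtypePerm (p := fun k : Fin N => (k : ℕ) < m) hp)
  have hy1 : ∀ k : Fin N, (k : ℕ) < m → y k = w k := fun k hk => by
    exact Equiv.Perm.ofSubtype_apply_of_mem (p := fun k : Fin N => (k : ℕ) < m) _ hk
  have hy2 : ∀ k : Fin N, ¬ (k : ℕ) < m → y k = k := fun k hk =>
    Equiv.Perm.ofSubtype_apply_of_not_mem _ hk
  have hz : ∀ k : Fin N, (k : ℕ) < m → (y⁻¹ * w) k = k := fun k hk => by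
    rw [Equiv.Perm.mul_apply, Equiv.Perm.inv_eq_iff_eq, hy1 k hk]
  rw [show w = y * (y⁻¹ * w) by group, below_mul_iff (fun k : Fin N => (k : ℕ) < m) hy2
    (fun k hk => rot_of_ge (by omega)) hz (fun k hk => rot_of_lt hk)] at hx
  refine ⟨y, y⁻¹ * w, (below_rot_of_fixed _ ?_).1 hx.1, hx.2, ?_⟩
  · rw [hy1 a ham, hwa]
  · rw [mul_inv_cancel_left, hw, Equiv.swap_mul_self_mul]

theorem mul_eq_mul_of_below_rot {a m : Fin N} {b : ℕ} (hb : b ≤ N)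
    {y z y' z' : Equiv.Perm (Fin N)}
    (hy : Below y (rot (a + 1) m m.2.le)) (hz : Below z (rot m b hb))
    (hy' : Below y' (rot (a + 1) m m.2.le)) (hz' : Below z' (rot m b hb))
    (h : y * z = y' * z') : y = y' ∧ z = z' := by
  have hyy : y = y' := by
    ext1 k
    by_cases hk : (k : ℕ) < m
    · have := congrArg (fun g : Equiv.Perm (Fin N) => g k) h
      simpa [Equiv.Perm.mul_apply, hz.fixed (rot_of_lt hk), hz'.fixed (rot_of_lt hk)] using this
    · rw [hy.fixed (rot_of_ge (by omega)), hy'.fixed (rot_of_ge (by omega))]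
  subst hyy
  exact ⟨rfl, mul_left_cancel h⟩

theorem finRotate_eq_rot : finRotate N = rot 0 N le_rfl := by
  rcases N with _ | N
  · exact Subsingleton.elim _ _
  · ext i
    rw [coe_finRotate, rot_val]
    simp only [Fin.ext_iff, Fin.val_last]
    split_ifs <;> omega

theorem mem_NC_iff {x : Equiv.Perm (Fin N)} : x ∈ NC N ↔ Below x (rot 0 N le_rfl) := by
  simp only [NC, PrefixLE, Set.mem_ofPred_eq, wordLength_transpositions, finRotate_eq_rot, Below]

/-! ### Cycles and Property OD -/

/-- A set of letters alternates if any two consecutive elements have different parity. -/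
def Alternating (B : Finset (Fin N)) : Prop :=
  ∀ u ∈ B, ∀ v ∈ B, u < v → (∀ w ∈ B, ¬ (u < w ∧ w < v)) → Odd ((u : ℕ) + v)

theorem lettersOD_iff (B : Finset (Fin N)) : LettersOD B ↔ Odd B.card ∧ Alternating B := by
  refine and_congr_right fun _ => ⟨fun h u hu v hv huv hw => ?_, fun h j hj => ?_⟩
  · have hr : ∀ u ∈ B, ∃ i, B.orderEmbOfFin rfl i = u := fun u hu => by
      have : u ∈ Set.range (B.orderEmbOfFin rfl) := by simpa using hu
      exact this
    obtain ⟨i, rfl⟩ := hr u hu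
    obtain ⟨k, rfl⟩ := hr v hv
    have hik : i < k := by simpa using huv
    have hik' : (i : ℕ) < k := hik
    have hk : (k : ℕ) = i + 1 := by
      by_contra hne
      refine hw (B.orderEmbOfFin rfl ⟨i + 1, by omega⟩) (by simp) ⟨?_, ?_⟩
      · simp [Fin.lt_def]
      · rw [OrderEmbedding.lt_iff_lt, Fin.lt_def]; simp only; omega
    have := h i (by omega)
    rw [show k = ⟨i + 1, by omega⟩ from Fin.ext hk]
    grind
  · have := h (B.orderEmbOfFin rfl ⟨j, by omega⟩) (by simp) (B.orderEmbOfFin rfl ⟨j + 1, hj⟩)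
      (by simp) (by simp [Fin.lt_def]) ?_
    · grind
    · intro w hw
      have : w ∈ Set.range (B.orderEmbOfFin rfl) := by simpa using hw
      obtain ⟨k, rfl⟩ := this
      rw [OrderEmbedding.lt_iff_lt, OrderEmbedding.lt_iff_lt, Fin.lt_def, Fin.lt_def]
      simp only
      omega

theorem alternating_insert_iff {B : Finset (Fin N)} {a m : Fin N} (ham : a < m) (hm : m ∈ B)
    (hB : ∀ u ∈ B, m ≤ u) : Alternating (insert a B) ↔ Odd ((m : ℕ) + a) ∧ Alternating B := by
  constructor
  · intro h
    refine ⟨?_, fun u hu v hv huv hw => ?_⟩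
    · rw [add_comm]
      refine h a (by simp) m (by simp [hm]) ham fun w hw hlt => ?_
      rcases Finset.mem_insert.1 hw with rfl | hw
      · exact lt_irrefl _ hlt.1
      · exact absurd (hB w hw) (not_le.2 hlt.2)
    · refine h u (by simp [hu]) v (by simp [hv]) huv fun w hw' hlt => ?_
      rcases Finset.mem_insert.1 hw' with rfl | hw'
      · exact absurd (hlt.1.trans ham) (not_lt.2 (hB u hu))
      · exact hw w hw' hlt
  · rintro ⟨h1, h2⟩ u hu v hv huv hw
    rcases Finset.mem_insert.1 hu with rfl | hu'
    · rcases Finset.mem_insert.1 hv with rfl | hv'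
      · exact absurd huv (lt_irrefl _)
      · have hmv : m = v := by
          by_contra hne
          exact hw m (by simp [hm]) ⟨ham, lt_of_le_of_ne (hB v hv') hne⟩
        subst hmv
        rwa [add_comm]
    · rcases Finset.mem_insert.1 hv with rfl | hv'
      · exact absurd (huv.trans ham) (not_lt.2 (hB u hu'))
      · exact h2 u hu' v hv' huv fun w hw' => hw w (by simp [hw'])

theorem mem_cycleLetters {x : Equiv.Perm (Fin N)} {i j : Fin N} :
    j ∈ cycleLetters x i ↔ x.SameCycle i j := by
  simp [cycleLetters]

theorem self_mem_cycleLetters (x : Equiv.Perm (Fin N)) (i : Fin N) : i ∈ cycleLetters x i :=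
  mem_cycleLetters.2 (Equiv.Perm.SameCycle.refl _ _)

theorem apply_mem_cycleLetters {x : Equiv.Perm (Fin N)} {i k : Fin N} :
    x k ∈ cycleLetters x i ↔ k ∈ cycleLetters x i := by
  simp only [mem_cycleLetters, Equiv.Perm.sameCycle_apply_right]

theorem cycleLetters_eq_of_mem {x : Equiv.Perm (Fin N)} {i j : Fin N}
    (h : j ∈ cycleLetters x i) : cycleLetters x j = cycleLetters x i := by
  rw [mem_cycleLetters] at h
  ext k
  rw [mem_cycleLetters, mem_cycleLetters]
  exact ⟨h.trans, h.symm.trans⟩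

/-- The cycle of `i` is contained in every set that contains `i` and is preserved by `x`. -/
theorem cycleLetters_induction {x : Equiv.Perm (Fin N)} {i j : Fin N} (p : Fin N → Prop)
    (hp : ∀ k, p (x k) ↔ p k) (hi : p i) (hj : j ∈ cycleLetters x i) : p j := by
  obtain ⟨n, rfl⟩ := mem_cycleLetters.1 hj
  have hinv : ∀ k, x (x⁻¹ k) = k := fun k => by simp
  induction n using Int.induction_on with
  | zero => simpa using hi
  | succ n ih =>
    rw [add_comm, zpow_add, zpow_one, Equiv.Perm.mul_apply, hp]
    exact ih (mem_cycleLetters.2 ⟨_, rfl⟩)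
  | pred n ih =>
    rw [sub_eq_neg_add, zpow_add, zpow_neg_one, Equiv.Perm.mul_apply, ← hp,
      hinv]
    exact ih (mem_cycleLetters.2 ⟨_, rfl⟩)

theorem cycleLetters_of_fixed {x : Equiv.Perm (Fin N)} {i : Fin N} (h : x i = i) :
    cycleLetters x i = {i} := by
  ext j
  rw [Finset.mem_singleton]
  refine ⟨fun hj => cycleLetters_induction (· = i) (fun k => ?_) rfl hj, ?_⟩
  · exact ⟨fun hk => x.injective (hk.trans h.symm), fun hk => by rw [hk, h]⟩
  · rintro rfl; exact self_mem_cycleLetters _ _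

theorem lettersOD_singleton (i : Fin N) : LettersOD {i} := by
  rw [lettersOD_iff]
  refine ⟨by simp, fun u hu v hv huv _ => ?_⟩
  rw [Finset.mem_singleton] at hu hv
  subst hu hv
  exact absurd huv (lt_irrefl _)

theorem cycleLetters_subset_of_eqOn {x w : Equiv.Perm (Fin N)} (p : Fin N → Prop)
    (hx : ∀ k, p (x k) ↔ p k) (h : ∀ k, p k → x k = w k) {i : Fin N} (hi : p i) :
    cycleLetters x i ⊆ cycleLetters w i := fun j hj => by
  refine (cycleLetters_induction (fun k => p k ∧ k ∈ cycleLetters w i) (fun k => ?_)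
    ⟨hi, self_mem_cycleLetters _ _⟩ hj).2
  rw [hx]
  refine and_congr_right fun hk => ?_
  rw [h k hk, apply_mem_cycleLetters]

/-- If two permutations agree on a set preserved by the second one, they have the same cycles
inside that set. -/
theorem cycleLetters_congr {x w : Equiv.Perm (Fin N)} (p : Fin N → Prop)
    (hw : ∀ k, p (w k) ↔ p k) (h : ∀ k, p k → x k = w k) {i : Fin N} (hi : p i) :
    cycleLetters x i = cycleLetters w i := by
  have hinv : ∀ k, w (w⁻¹ k) = k := fun k => by simp
  have hx : ∀ k, p (x k) ↔ p k := fun k => by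
    refine ⟨fun hk => ?_, fun hk => by rw [h k hk, hw]; exact hk⟩
    have h1 : p (w⁻¹ (x k)) := by rw [← hw, hinv]; exact hk
    have h2 := h _ h1
    rw [hinv] at h2
    rwa [x.injective h2] at h1
  exact (cycleLetters_subset_of_eqOn p hx h hi).antisymm
    (cycleLetters_subset_of_eqOn p hw (fun k hk => (h k hk).symm) hi)

theorem cycleLetters_swap_mul_of_notMem {w : Equiv.Perm (Fin N)} {a m i : Fin N}
    (hw : w a = a) (hi : i ≠ a) (him : i ∉ cycleLetters w m) :
    cycleLetters (Equiv.swap a m * w) i = cycleLetters w i := by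
  refine cycleLetters_congr (· ∈ cycleLetters w i) (fun k => apply_mem_cycleLetters)
    (fun k hk => ?_) (self_mem_cycleLetters _ _)
  have hk' := apply_mem_cycleLetters.2 hk
  rw [Equiv.Perm.mul_apply, Equiv.swap_apply_of_ne_of_ne]
  · intro h
    rw [h] at hk'
    have h1 := self_mem_cycleLetters w i
    rw [← cycleLetters_eq_of_mem hk', cycleLetters_of_fixed hw, Finset.mem_singleton] at h1
    exact hi h1
  · intro h
    rw [h] at hk'
    exact him (by rw [cycleLetters_eq_of_mem hk']; exact self_mem_cycleLetters _ _)

theorem cycleLetters_swap_mul {w : Equiv.Perm (Fin N)} {a m : Fin N} (hw : w a = a) :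
    cycleLetters (Equiv.swap a m * w) a = insert a (cycleLetters w m) := by
  set x := Equiv.swap a m * w with hx
  have hxa : x a = m := by simp [hx, hw]
  have hwk : ∀ k, w k = a → k = a := fun k hk => w.injective (hk.trans hw.symm)
  have hxm : ∀ k, w k = m → x k = a := fun k hk => by simp [hx, hk]
  have hxk : ∀ k, w k ≠ a → w k ≠ m → x k = w k := fun k h1 h2 => by
    rw [hx, Equiv.Perm.mul_apply, Equiv.swap_apply_of_ne_of_ne h1 h2]
  apply Finset.Subset.antisymm
  · intro j hj
    rw [Finset.mem_insert]
    refine cycleLetters_induction (fun k => k = a ∨ k ∈ cycleLetters w m) (fun k => ?_)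
      (Or.inl rfl) hj
    by_cases h1 : w k = a
    · have := hwk k h1
      subst this
      simp [hxa, self_mem_cycleLetters]
    · by_cases h2 : w k = m
      · have h3 : k ∈ cycleLetters w m := by
          rw [← apply_mem_cycleLetters, h2]; exact self_mem_cycleLetters _ _
        simp [hxm k h2, h3]
      · have h3 : k ≠ a := by rintro rfl; exact h1 hw
        rw [hxk k h1 h2, apply_mem_cycleLetters]
        simp [h1, h3]
  · have hm : m ∈ cycleLetters x a := by
      rw [← hxa, apply_mem_cycleLetters]; exact self_mem_cycleLetters _ _
    refine Finset.insert_subset (self_mem_cycleLetters _ _) fun j hj => ?_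
    refine cycleLetters_induction (· ∈ cycleLetters x a) (fun k => ?_) hm hj
    by_cases h1 : w k = a
    · rw [hwk k h1, hw]
    · by_cases h2 : w k = m
      · rw [h2, ← apply_mem_cycleLetters (k := k), hxm k h2]
        simp [hm, self_mem_cycleLetters]
      · rw [← hxk k h1 h2, apply_mem_cycleLetters]

/-- The cycle of `a` in `x` alternates and has `q` letters with `q + p` odd, and all other cycles
of `x` satisfy Property OD. For even `p` this is Property OD; for odd `p` it is the condition that
remains of it once a letter is removed from the cycle of `a`. -/
def FirstCycle (p : ℕ) (x : Equiv.Perm (Fin N)) (a : Fin N) : Prop :=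
  Odd ((cycleLetters x a).card + p) ∧ Alternating (cycleLetters x a) ∧
    ∀ i ∉ cycleLetters x a, LettersOD (cycleLetters x i)

theorem firstCycle_of_even {p : ℕ} (hp : Even p) {x : Equiv.Perm (Fin N)} {a : Fin N} :
    FirstCycle p x a ↔ PropertyOD x := by
  have h : Odd ((cycleLetters x a).card + p) ↔ Odd (cycleLetters x a).card := by
    rw [Nat.odd_add]; simp [hp]
  rw [FirstCycle, h, ← and_assoc, ← lettersOD_iff]
  refine ⟨fun hx i => ?_, fun hx => ⟨hx a, fun i _ => hx i⟩⟩
  by_cases hi : i ∈ cycleLetters x a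
  · rw [cycleLetters_eq_of_mem hi]; exact hx.1
  · exact hx.2 i hi

theorem not_firstCycle_of_odd {p : ℕ} (hp : Odd p) {x : Equiv.Perm (Fin N)} {a : Fin N}
    (ha : x a = a) : ¬ FirstCycle p x a := by
  rintro ⟨h, -⟩
  rw [cycleLetters_of_fixed ha, Finset.card_singleton] at h
  grind

/-- How the condition on the first cycle decomposes along `x = (a m) * (y * z)`: the cycle of `a`
in `x` consists of `a` and of the cycle of `m` in `z`, and the other cycles of `x` are the other
cycles of `y` and `z`. -/
theorem firstCycle_swap_mul_iff {p : ℕ} {a m : Fin N} (ham : a < m) {y z : Equiv.Perm (Fin N)}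
    (hya : y a = a) (hy : ∀ k, m ≤ k → y k = k) (hz : ∀ k, k < m → z k = k) :
    FirstCycle p (Equiv.swap a m * (y * z)) a ↔
      Odd ((m : ℕ) + a) ∧ PropertyOD y ∧ FirstCycle (p + 1) z m := by
  have hyp : ∀ k, y k < m ↔ k < m := fun k => by
    by_cases hk : k < m
    · refine iff_of_true ?_ hk
      by_contra h
      have := y.injective (hy _ (not_lt.1 h))
      rw [this] at h
      exact h hk
    · rw [hy k (not_lt.1 hk)]
  have hzp : ∀ k, m ≤ z k ↔ m ≤ k := fun k => by
    by_cases hk : m ≤ k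
    · refine iff_of_true ?_ hk
      by_contra h
      have := z.injective (hz _ (not_le.1 h))
      rw [this] at h
      exact h hk
    · rw [hz k (not_le.1 hk)]
  have hwy : ∀ i, i < m → cycleLetters (y * z) i = cycleLetters y i := fun i hi =>
    cycleLetters_congr (· < m) hyp (fun k hk => by rw [Equiv.Perm.mul_apply, hz k hk]) hi
  have hwz : ∀ i, m ≤ i → cycleLetters (y * z) i = cycleLetters z i := fun i hi =>
    cycleLetters_congr (m ≤ ·) hzp
      (fun k hk => by rw [Equiv.Perm.mul_apply, hy _ ((hzp k).2 hk)]) hi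
  have hwa : (y * z) a = a := by rw [Equiv.Perm.mul_apply, hz a ham, hya]
  have hCa : cycleLetters (Equiv.swap a m * (y * z)) a = insert a (cycleLetters z m) := by
    rw [cycleLetters_swap_mul hwa, hwz m le_rfl]
  have hge : ∀ u ∈ cycleLetters z m, m ≤ u := fun u hu =>
    cycleLetters_induction (m ≤ ·) hzp le_rfl hu
  have haz : a ∉ cycleLetters z m := fun h => absurd (hge a h) (not_le.2 ham)
  have hC : ∀ i, i ≠ a → i ∉ cycleLetters z m →
      cycleLetters (Equiv.swap a m * (y * z)) i = cycleLetters (y * z) i := fun i hi him =>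
    cycleLetters_swap_mul_of_notMem hwa hi (by rwa [hwz m le_rfl])
  have hother : (∀ i ∉ insert a (cycleLetters z m),
        LettersOD (cycleLetters (Equiv.swap a m * (y * z)) i)) ↔
      PropertyOD y ∧ ∀ i ∉ cycleLetters z m, LettersOD (cycleLetters z i) := by
    simp only [Finset.mem_insert, not_or]
    constructor
    · refine fun h => ⟨fun i => ?_, fun i hi => ?_⟩
      · by_cases hi : y i = i
        · rw [cycleLetters_of_fixed hi]; exact lettersOD_singleton i
        · have him : i < m := by
            by_contra him
            exact hi (hy i (not_lt.1 him))
          have hia : i ≠ a := by rintro rfl; exact hi hya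
          have hiz : i ∉ cycleLetters z m := fun hmem => absurd (hge i hmem) (not_le.2 him)
          rw [← hwy i him, ← hC i hia hiz]
          exact h i ⟨hia, hiz⟩
      · by_cases him : i < m
        · rw [cycleLetters_of_fixed (hz i him)]; exact lettersOD_singleton i
        · have hia : i ≠ a := by rintro rfl; exact him ham
          rw [← hwz i (not_lt.1 him), ← hC i hia hi]
          exact h i ⟨hia, hi⟩
    · rintro ⟨h1, h2⟩ i ⟨hia, hiz⟩
      rw [hC i hia hiz]
      by_cases him : i < m
      · rw [hwy i him]; exact h1 i
      · rw [hwz i (not_lt.1 him)]; exact h2 i hiz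
  have hcard : (cycleLetters z m).card + 1 + p = (cycleLetters z m).card + (p + 1) := by ring
  rw [FirstCycle, FirstCycle, hCa, hother, Finset.card_insert_of_notMem haz, hcard,
    alternating_insert_iff ham (self_mem_cycleLetters z m) hge]
  tauto

end Letters

/-! ### The ternary tree series -/

/-- The coefficient of `X ^ n` in `B ^ p`, where `B = 1 + X ^ 2 * B ^ 3`. The recursion reflects
`B ^ (p + 1) = B ^ p + X ^ 2 * B ^ (p + 3)`. -/
def ternaryCoeff : ℕ → ℕ → ℕ
  | _, 0 => 1
  | _, 1 => 0
  | 0, _ + 2 => 0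
  | p + 1, n + 2 => ternaryCoeff p (n + 2) + ternaryCoeff (p + 3) n
termination_by p n => (n, p)

theorem ternaryCoeff_zero_right (p : ℕ) : ternaryCoeff p 0 = 1 := by
  simp [ternaryCoeff]

theorem ternaryCoeff_zero_left (n : ℕ) : ternaryCoeff 0 n = if n = 0 then 1 else 0 := by
  match n with
  | 0 => simp [ternaryCoeff]
  | 1 => simp [ternaryCoeff]
  | n + 2 => simp [ternaryCoeff]

theorem ternaryCoeff_succ (p n : ℕ) :
    ternaryCoeff (p + 1) (n + 2) = ternaryCoeff p (n + 2) + ternaryCoeff (p + 3) n := by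
  rw [ternaryCoeff]

theorem ternaryCoeff_odd (k : ℕ) : ∀ p, ternaryCoeff p (2 * k + 1) = 0 := by
  induction k with
  | zero => intro p; simp [ternaryCoeff]
  | succ k ih =>
    intro p
    induction p with
    | zero => simp [ternaryCoeff_zero_left]
    | succ p ihp =>
      rw [show 2 * (k + 1) + 1 = 2 * k + 1 + 2 by ring] at *
      rw [ternaryCoeff_succ, ihp, ih]

theorem add_mul_ternaryCoeff (k : ℕ) :
    ∀ p, (p + 3 * k) * ternaryCoeff p (2 * k) = p * (p + 3 * k).choose k := by
  induction k with
  | zero => intro p; simp [ternaryCoeff_zero_right]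
  | succ k ih =>
    intro p
    induction p with
    | zero => simp [ternaryCoeff_zero_left]
    | succ p ihp =>
      have h2 : 2 * (k + 1) = 2 * k + 2 := by ring
      have h3 := ih (p + 3)
      rw [h2] at ihp ⊢
      rw [ternaryCoeff_succ]
      obtain ⟨M, hM⟩ : ∃ M, M = p + 3 * (k + 1) := ⟨_, rfl⟩
      rw [show p + 3 + 3 * k = M by omega] at h3
      rw [← hM] at ihp
      rw [show p + 1 + 3 * (k + 1) = M + 1 by omega, Nat.choose_succ_succ]
      have h4 := Nat.choose_succ_right_eq M k
      obtain ⟨d, hd⟩ : ∃ d, d = M - k := ⟨_, rfl⟩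
      rw [← hd] at h4
      have hMd : M = d + k := by omega
      have hM0 : (M : ℤ) ≠ 0 := by omega
      zify at h3 ih ihp h4 hMd hM ⊢
      apply mul_left_cancel₀ hM0
      linear_combination ((M : ℤ) + 1) * ihp + ((M : ℤ) + 1) * h3 - 3 * h4 +
        3 * (M.choose k : ℤ) * hMd - ((M.choose k : ℤ) + (M.choose (k + 1) : ℤ)) * hM

theorem ternaryCoeff_one_eq (n : ℕ) :
    (ternaryCoeff 1 (2 * n) : ℚ) = 1 / (2 * (n : ℚ) + 1) * (((3 * n).choose n : ℕ) : ℚ) := by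
  have h1 := add_mul_ternaryCoeff n 1
  have h2 := Nat.add_one_mul_choose_eq (3 * n) (2 * n)
  have h3 : (3 * n).choose (2 * n) = (3 * n).choose n := Nat.choose_symm_of_eq_add (by ring)
  have h4 : (3 * n + 1).choose (2 * n + 1) = (1 + 3 * n).choose n := by
    rw [add_comm 1]; exact Nat.choose_symm_of_eq_add (by ring)
  rw [h3, h4] at h2
  have h5 : (2 * n + 1) * ternaryCoeff 1 (2 * n) = (3 * n).choose n := by
    apply Nat.eq_of_mul_eq_mul_left (show 0 < 3 * n + 1 by omega)
    linear_combination (2 * n + 1) * h1 - h2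
  rw [← h5]
  push_cast
  field_simp

/-- The power series whose coefficients are `ternaryCoeff p`. -/
noncomputable def ternarySeries (p : ℕ) : PowerSeries ℚ :=
  PowerSeries.mk fun n => (ternaryCoeff p n : ℚ)

theorem ternarySeries_zero : ternarySeries 0 = 1 := by
  ext n
  simp [ternarySeries, ternaryCoeff_zero_left, PowerSeries.coeff_one]

open PowerSeries in
theorem ternarySeries_succ (p : ℕ) :
    ternarySeries (p + 1) = ternarySeries p + X ^ 2 * ternarySeries (p + 3) := by
  ext n
  match n with
  | 0 => simp [ternarySeries, ternaryCoeff]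
  | 1 => simp [ternarySeries, ternaryCoeff, coeff_X_pow_mul']
  | n + 2 => simp [ternarySeries, ternaryCoeff_succ, coeff_X_pow_mul]

open PowerSeries in
theorem ternarySeries_mul (p q : ℕ) :
    ternarySeries p * ternarySeries q = ternarySeries (p + q) := by
  -- Both sides obey the recursion of `ternarySeries_succ` in `p`, so their coefficients agree
  -- by induction on the degree and then on `p`.
  have key : ∀ n, ∀ p q, coeff n (ternarySeries p * ternarySeries q) =
      coeff n (ternarySeries (p + q)) := by
    intro n
    induction n using Nat.strong_induction_on with
    | _ n ih =>
      intro p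
      induction p with
      | zero => intro q; rw [ternarySeries_zero, one_mul, zero_add]
      | succ p ihp =>
        intro q
        rw [show p + 1 + q = p + q + 1 by ring, ternarySeries_succ p, ternarySeries_succ (p + q),
          add_mul, map_add, map_add, ihp, mul_assoc, coeff_X_pow_mul', coeff_X_pow_mul']
        congr 1
        split_ifs with h
        · rw [ih (n - 2) (by omega)]; congr 2; ring
        · rfl
  ext n
  exact key n p q

open PowerSeries in
theorem ternarySeries_one_eq :
    ternarySeries 1 = 1 + X ^ 2 * ternarySeries 1 ^ 3 := by
  have h : ternarySeries 1 ^ 3 = ternarySeries 3 := by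
    rw [pow_succ, pow_two, ternarySeries_mul, ternarySeries_mul]
  rw [h]
  conv_lhs => rw [show 1 = 0 + 1 by rfl, ternarySeries_succ, ternarySeries_zero]

open PowerSeries in
/-- For even `p` and for odd `p`, the generating functions of the noncrossing permutations
(of at least one letter) whose cycle through the first letter is alternating with `card + p` odd,
and whose other cycles satisfy Property OD. -/
noncomputable def firstSeries (p : ℕ) : PowerSeries ℚ :=
  if Even p then X ^ 2 * ternarySeries 1 ^ 3 + X * ternarySeries 1 ^ 2
  else X * ternarySeries 1 * (X ^ 2 * ternarySeries 1 ^ 3 + X * ternarySeries 1 ^ 2)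

open PowerSeries in
theorem firstSeries_of_odd {p : ℕ} (hp : ¬ Even p) :
    firstSeries p = X * (ternarySeries 1 * firstSeries (p + 1)) := by
  have : Even (p + 1) := by rw [Nat.even_add_one]; exact hp
  rw [firstSeries, firstSeries, if_neg hp, if_pos this]
  ring

open PowerSeries in
theorem firstSeries_of_even {p : ℕ} (hp : Even p) :
    firstSeries p =
      X * (1 + firstSeries 0) + X * (ternarySeries 1 * firstSeries (p + 1)) := by
  have : ¬ Even (p + 1) := by rw [Nat.even_add_one]; exact not_not.2 hp
  rw [firstSeries, firstSeries, firstSeries, if_pos hp, if_neg this, if_pos (by simp)]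
  have h := ternarySeries_one_eq
  linear_combination (X * ternarySeries 1 + X + X ^ 2 * ternarySeries 1 ^ 2) * h

open PowerSeries in
theorem coeff_zero_firstSeries (p : ℕ) : coeff 0 (firstSeries p) = 0 := by
  by_cases hp : Even p <;> simp [firstSeries, hp]

theorem one_add_firstSeries :
    1 + firstSeries 0 = ternarySeries 1 + PowerSeries.X * ternarySeries 2 := by
  rw [firstSeries, if_pos (by simp), ← add_assoc, ← ternarySeries_one_eq, pow_two,
    ternarySeries_mul]

open PowerSeries in
theorem coeff_one_add_firstSeries_of_even {n : ℕ} (hn : Even n) :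
    coeff n (1 + firstSeries 0) = (ternaryCoeff 1 n : ℚ) := by
  obtain ⟨k, rfl⟩ := hn.two_dvd
  rw [one_add_firstSeries, map_add]
  rcases k with _ | k
  · simp [ternarySeries]
  · rw [show 2 * (k + 1) = 2 * k + 1 + 1 by ring, coeff_succ_X_mul]
    simp [ternarySeries, ternaryCoeff_odd]

/-! ### Counting -/

section Counting

variable {N : ℕ}

open Classical in
/-- The number of permutations below the cycle of `[a, b)` with Property OD. -/
noncomputable def countOD (a b : ℕ) (hb : b ≤ N) : ℕ :=
  (Finset.univ.filter fun x : Equiv.Perm (Fin N) => Below x (rot a b hb) ∧ PropertyOD x).card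

open Classical in
/-- The number of permutations below the cycle of `[a, b)` that satisfy `FirstCycle p` at `a`. -/
noncomputable def countFirst (p : ℕ) (a : Fin N) (b : ℕ) (hb : b ≤ N) : ℕ :=
  (Finset.univ.filter fun x : Equiv.Perm (Fin N) =>
    Below x (rot a b hb) ∧ FirstCycle p x a).card

theorem countOD_of_le {a b : ℕ} (hb : b ≤ N) (h : b ≤ a) : countOD a b hb = 1 := by
  classical
  rw [countOD, Finset.card_eq_one]
  refine ⟨1, Finset.ext fun x => ?_⟩
  rw [Finset.mem_filter_univ, Finset.mem_singleton, rot_eq_one (by omega), below_one_iff]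
  refine ⟨fun hx => hx.1, fun hx => ⟨hx, fun i => ?_⟩⟩
  rw [hx, cycleLetters_of_fixed rfl]
  exact lettersOD_singleton i

theorem countFirst_of_even {p : ℕ} (hp : Even p) (a : Fin N) (b : ℕ) (hb : b ≤ N) :
    countFirst p a b hb = countOD a b hb := by
  classical
  rw [countFirst, countOD]
  congr 1
  exact Finset.filter_congr fun x _ => by rw [firstCycle_of_even hp]

open Classical in
theorem card_filter_fixed (p : ℕ) (a : Fin N) (b : ℕ) (hb : b ≤ N) :
    (Finset.univ.filter fun x : Equiv.Perm (Fin N) =>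
      (Below x (rot a b hb) ∧ FirstCycle p x a) ∧ x a = a).card =
      if Even p then countOD (a + 1) b hb else 0 := by
  split_ifs with hp
  · rw [countOD]
    congr 1
    refine Finset.filter_congr fun x _ => ?_
    rw [firstCycle_of_even hp]
    constructor
    · rintro ⟨⟨h1, h2⟩, h3⟩
      exact ⟨(below_rot_of_fixed hb h3).1 h1, h2⟩
    · rintro ⟨h1, h2⟩
      have h3 : x a = a := h1.fixed (rot_of_lt (by omega))
      exact ⟨⟨(below_rot_of_fixed hb h3).2 h1, h2⟩, h3⟩
  · rw [Finset.card_eq_zero, Finset.filter_eq_empty_iff]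
    rintro x - ⟨⟨-, h1⟩, h2⟩
    exact not_firstCycle_of_odd (Nat.not_even_iff_odd.1 hp) h2 h1

open Classical in
theorem card_filter_apply (p : ℕ) {a m : Fin N} {b : ℕ} (hb : b ≤ N) (ham : a < m)
    (hmb : (m : ℕ) < b) :
    (Finset.univ.filter fun x : Equiv.Perm (Fin N) =>
      (Below x (rot a b hb) ∧ FirstCycle p x a) ∧ x a = m).card =
      if Odd ((m : ℕ) + a) then countOD (a + 1) m m.2.le * countFirst (p + 1) m b hb else 0 := by
  have hiff : ∀ {y z : Equiv.Perm (Fin N)}, Below y (rot (a + 1) m m.2.le) →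
      Below z (rot m b hb) → (FirstCycle p (Equiv.swap a m * (y * z)) a ↔
        Odd ((m : ℕ) + a) ∧ PropertyOD y ∧ FirstCycle (p + 1) z m) := fun hy hz =>
    firstCycle_swap_mul_iff ham (hy.fixed (rot_of_lt (by omega)))
      (fun k hk => hy.fixed (rot_of_ge hk)) (fun k hk => hz.fixed (rot_of_lt hk))
  split_ifs with hodd
  · rw [countOD, countFirst, ← Finset.card_product]
    symm
    refine Finset.card_nbij (fun q => Equiv.swap a m * (q.1 * q.2)) ?_ ?_ ?_
    · rintro ⟨y, z⟩ hq
      simp only [Finset.coe_product, Set.mem_prod, Finset.mem_coe, Finset.mem_filter_univ] at hq ⊢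
      obtain ⟨⟨hy, hy'⟩, hz, hz'⟩ := hq
      have h1 := below_swap_mul hb ham hmb hy hz
      exact ⟨⟨h1.1, (hiff hy hz).2 ⟨hodd, hy', hz'⟩⟩, h1.2⟩
    · rintro ⟨y, z⟩ hq ⟨y', z'⟩ hq' he
      simp only [Finset.coe_product, Set.mem_prod, Finset.mem_coe, Finset.mem_filter_univ] at hq hq'
      have h1 := mul_eq_mul_of_below_rot hb hq.1.1 hq.2.1 hq'.1.1 hq'.2.1 (mul_left_cancel he)
      exact Prod.ext h1.1 h1.2
    · intro x hx
      simp only [Finset.mem_coe, Finset.mem_filter_univ] at hx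
      obtain ⟨y, z, hy, hz, rfl⟩ := exists_of_below_rot hb ham hmb hx.1.1 hx.2
      have h1 := (hiff hy hz).1 hx.1.2
      refine ⟨(y, z), ?_, rfl⟩
      simp only [Finset.coe_product, Set.mem_prod, Finset.mem_coe, Finset.mem_filter_univ]
      exact ⟨⟨hy, h1.2.1⟩, hz, h1.2.2⟩
  · rw [Finset.card_eq_zero, Finset.filter_eq_empty_iff]
    rintro x - ⟨⟨h1, h2⟩, h3⟩
    obtain ⟨y, z, hy, hz, rfl⟩ := exists_of_below_rot hb ham hmb h1 h3
    exact hodd ((hiff hy hz).1 h2).1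

/-- The recursion obtained by sorting the permutations `x` by the letter `m = x a`. -/
theorem countFirst_eq (p : ℕ) {a : Fin N} {b : ℕ} (hb : b ≤ N) (hab : (a : ℕ) < b) :
    countFirst p a b hb = (if Even p then countOD (a + 1) b hb else 0) +
      ∑ m : Fin N, if a < m ∧ (m : ℕ) < b then
        (if Odd ((m : ℕ) + a) then countOD (a + 1) m m.2.le * countFirst (p + 1) m b hb else 0)
      else 0 := by
  classical
  rw [countFirst, Finset.card_eq_sum_card_fiberwise (f := fun x => x a) (t := Finset.univ)
    (fun _ _ => Finset.mem_coe.2 (Finset.mem_univ _)),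
    ← Finset.add_sum_erase _ _ (Finset.mem_univ a)]
  simp only [Finset.filter_filter]
  rw [card_filter_fixed, ← Finset.add_sum_erase (a := a) (s := Finset.univ) (f := fun m : Fin N =>
    if a < m ∧ (m : ℕ) < b then
        (if Odd ((m : ℕ) + a) then countOD (a + 1) m m.2.le * countFirst (p + 1) m b hb else 0)
      else 0) (Finset.mem_univ a),
    if_neg (show ¬ (a < a ∧ (a : ℕ) < b) from fun h => lt_irrefl _ h.1), zero_add]
  congr 1
  refine Finset.sum_congr rfl fun m hm => ?_
  split_ifs with h1 h2
  · rw [card_filter_apply p hb h1.1 h1.2, if_pos h2]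
  · rw [card_filter_apply p hb h1.1 h1.2, if_neg h2]
  · rw [Finset.card_eq_zero, Finset.filter_eq_empty_iff]
    rintro x - ⟨⟨h3, -⟩, h4⟩
    -- `x` preserves `[a, b)`, so its value at `a` lies in this interval.
    have hp := h3.preserves (fun k : Fin N => a ≤ k ∧ (k : ℕ) < b) (fun k => by
      rw [Fin.le_def, Fin.le_def, rot_val]
      split_ifs <;> omega) a
    rw [h4] at hp
    have h5 := hp.2 ⟨le_rfl, hab⟩
    exact h1 ⟨lt_of_le_of_ne h5.1 (Finset.ne_of_mem_erase hm).symm, h5.2⟩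

open PowerSeries in
/-- By induction on the number of letters: the counts and the coefficients of the generating
functions satisfy the same recursion. -/
theorem counts_eq_coeff (n : ℕ) : (∀ (a b : ℕ) (hb : b ≤ N), b - a = n →
      (countOD a b hb : ℚ) = coeff n (1 + firstSeries 0)) ∧
    ∀ (p : ℕ) (a : Fin N) (b : ℕ) (hb : b ≤ N), (a : ℕ) < b → b - a = n →
      (countFirst p a b hb : ℚ) = coeff n (firstSeries p) := by
  induction n using Nat.strong_induction_on with
  | _ n ih =>
  have hfirst : ∀ (p : ℕ) (a : Fin N) (b : ℕ) (hb : b ≤ N), (a : ℕ) < b → b - a = n →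
      (countFirst p a b hb : ℚ) = coeff n (firstSeries p) := by
    intro p a b hb hab hn
    obtain ⟨k, rfl⟩ : ∃ k, n = k + 1 := ⟨n - 1, by omega⟩
    have hsum : ((∑ m : Fin N, if a < m ∧ (m : ℕ) < b then
        (if Odd ((m : ℕ) + a) then countOD (a + 1) m m.2.le * countFirst (p + 1) m b hb else 0)
      else 0 : ℕ) : ℚ) = coeff (k + 1) (X * (ternarySeries 1 * firstSeries (p + 1))) := by
      have hterm : ∀ m : Fin N, ((if a < m ∧ (m : ℕ) < b then
          (if Odd ((m : ℕ) + a) then countOD (a + 1) m m.2.le * countFirst (p + 1) m b hb else 0)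
          else 0 : ℕ) : ℚ) = if (m : ℕ) ∈ Finset.Ico ((a : ℕ) + 1) b then
            coeff (m - (a + 1)) (ternarySeries 1) * coeff (b - m) (firstSeries (p + 1))
          else 0 := by
        intro m
        by_cases hm : a < m ∧ (m : ℕ) < b
        · have ham : (a : ℕ) < m := hm.1
          rw [if_pos hm, if_pos (Finset.mem_Ico.2 ⟨ham, hm.2⟩), ternarySeries, coeff_mk]
          split_ifs with hodd
          · rw [Nat.cast_mul, (ih _ (by omega)).1 _ _ _ rfl, (ih _ (by omega)).2 _ _ _ _ hm.2 rfl,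
              coeff_one_add_firstSeries_of_even (by grind)]
          · -- The gap between `a` and `m` has an odd number of letters, and the coefficients of
            -- `ternarySeries 1` in odd degrees vanish.
            obtain ⟨r, hr⟩ : ∃ r, (m : ℕ) - (a + 1) = 2 * r + 1 := by
              have : Odd ((m : ℕ) - (a + 1)) := by grind
              exact this
            rw [hr, ternaryCoeff_odd]
            simp
        · rw [if_neg hm, if_neg (by rw [Finset.mem_Ico]; exact hm)]
          simp
      rw [Nat.cast_sum, Finset.sum_congr rfl fun m _ => hterm m,
        Fin.sum_univ_eq_sum_range (fun m => if m ∈ Finset.Ico ((a : ℕ) + 1) b then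
            coeff (m - (a + 1)) (ternarySeries 1) * coeff (b - m) (firstSeries (p + 1))
          else 0) N, Finset.sum_ite_mem,
        Finset.inter_eq_right.2 (fun m hm => by
          rw [Finset.mem_range]; exact (Finset.mem_Ico.1 hm).2.trans_le hb),
        Finset.sum_Ico_eq_sum_range, coeff_succ_X_mul, coeff_mul,
        Finset.Nat.sum_antidiagonal_eq_sum_range_succ_mk, Finset.sum_range_succ, Nat.sub_self,
        coeff_zero_firstSeries, mul_zero, add_zero, show b - (a + 1) = k by omega]
      refine Finset.sum_congr rfl fun i _ => ?_
      rw [show (a : ℕ) + 1 + i - (a + 1) = i by omega, show b - (a + 1 + i) = k - i by omega]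
    rw [countFirst_eq p hb hab, Nat.cast_add, hsum]
    by_cases hp : Even p
    · rw [if_pos hp, firstSeries_of_even hp, map_add, coeff_succ_X_mul k (1 + _),
        (ih k (by omega)).1 _ _ _ (by omega)]
    · rw [if_neg hp, firstSeries_of_odd hp, Nat.cast_zero, zero_add]
  refine ⟨fun a b hb hn => ?_, hfirst⟩
  rcases Nat.eq_zero_or_pos n with rfl | h0
  · rw [countOD_of_le hb (by omega), map_add, coeff_zero_firstSeries]
    simp
  · have h1 := hfirst 0 ⟨a, by omega⟩ b hb (show a < b by omega) hn
    rw [countFirst_of_even (by simp)] at h1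
    rw [h1, map_add, coeff_one, if_neg (by omega), zero_add]

end Counting

theorem mainTheorem12 (n : ℕ) (hn : 1 ≤ n) :
    ((ONC (2 * n)).ncard : ℚ) = 1 / (2 * (n : ℚ) + 1) * (((3 * n).choose n : ℕ) : ℚ) := by
  classical
  have h : (ONC (2 * n)).ncard = countOD 0 (2 * n) le_rfl := by
    rw [countOD, ← Set.ncard_coe_finset]
    congr 1
    ext x
    simp [ONC, mem_NC_iff]
  rw [h, (counts_eq_coeff (2 * n)).1 0 (2 * n) le_rfl (by omega),
    coeff_one_add_firstSeries_of_even (by simp), ternaryCoeff_one_eq]
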